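/- For $n\ge 0$ let $c_5(n)$ denote the number of partitions of $n$ in which either (a) all parts are even and distinct (this includes the empty partition of $0$), or (b) at least one odd part occurs and, with $m$ the largest odd part, every odd integer $1,3,5,\dots,m$ occurs as a part, each of these odd parts appears exactly two or three times, the even parts (if any) are distinct, and every even part is at least $2m+4$. Then for all $n\geq 0$, $$c_5(n)\equiv\begin{cases}1\pmod 2, & \text{if } n=(7j^2+j)/2 \text{ for some } j\in\mathbb{Z},\\ 0\pmod 2, & \text{otherwise.}\end{cases}$$ -/

import Mathlib

/-- All parts of `p` are even and distinct (the empty partition of `0` included). -/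
def IsDistinctEven {n : ℕ} (p : n.Partition) : Prop :=
  (∀ k ∈ p.parts, Even k) ∧ p.parts.Nodup

/-- `p` has an odd part; its odd parts are gap-free (with `m` the largest odd part, all of
`1, 3, 5, …, m` are parts), each of them appears twice or thrice, and the even parts are distinct
and all at least `2 * m + 4`. -/
def IsGapFreeOdd {n : ℕ} (p : n.Partition) : Prop :=
  ∃ m ∈ p.parts, Odd m ∧
    (∀ k ∈ p.parts, Odd k → k ≤ m) ∧
    (∀ k ≤ m, Odd k → k ∈ p.parts) ∧
    (∀ k ∈ p.parts, Odd k → p.parts.count k = 2 ∨ p.parts.count k = 3) ∧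
    (∀ k ∈ p.parts, Even k → p.parts.count k = 1 ∧ 2 * m + 4 ≤ k)

open Classical in
/-- The number of partitions of `n` whose parts are all even and distinct, or which satisfy
`IsGapFreeOdd`. -/
noncomputable def c5 (n : ℕ) : ℕ :=
  (Finset.univ.filter fun p : n.Partition => IsDistinctEven p ∨ IsGapFreeOdd p).card

/-! Write (q)_n for `qPoch q n`. If a counted partition has k distinct odd parts, it consists of 1,
3, …, 2k-1 taken twice (total 2k²), a subset of these taken once more, and distinct even parts above
4k. Hence ∑ c5(n) q^n = ∑_k q^(2k²) ∏_{i<k} (1+q^(2i+1)) ∏_{i>2k} (1+q^(2i)). Modulo 2, 1+q^(2i) =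
(1+q^i)², so this is (q)_∞² ∑_k q^(2k²) / ((q)_k² (q)_{2k}), a Rogers–Selberg series; it equals
∑_{j∈ℤ} q^((7j²+j)/2). That identity comes from moving the unit Bailey pair (`sum_unitBailey`) twice
along a Bailey chain: `sum_unitBailey_mul_pow` also changes the base from q to q², and
`sum_pow_div_qPoch_eq_sum_unitBailey` is an ordinary step in base q². Each step is a `q`-Vandermonde
sum. Everything stays finite, with a cutoff N, and `coeff_sum_oddPoch` shows that the cutoff does
not affect coefficients of degree at most N. -/

open Finset

/-- The product `(1 + q) (1 + q ^ 2) ⋯ (1 + q ^ n)`, which in characteristic two is the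
`q`-Pochhammer symbol `(q; q)_n`. -/
def qPoch {R : Type*} [CommSemiring R] (q : R) (n : ℕ) : R :=
  ∏ i ∈ range n, (1 + q ^ (i + 1))

/-- Gaussian binomial coefficients, defined by their Pascal recursion. -/
def gaussBinom {R : Type*} [CommSemiring R] (q : R) : ℕ → ℕ → R
  | _, 0 => 1
  | 0, _ + 1 => 0
  | n + 1, k + 1 => gaussBinom q n k + q ^ (k + 1) * gaussBinom q n (k + 1)

/-! ### Gaussian binomials and `q`-Vandermonde. -/

section Semiring

variable {R : Type*} [CommSemiring R]

@[simp] lemma qPoch_zero (q : R) : qPoch q 0 = 1 := by simp [qPoch]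

lemma qPoch_succ (q : R) (n : ℕ) : qPoch q (n + 1) = qPoch q n * (1 + q ^ (n + 1)) := by
  simp [qPoch, prod_range_succ]

@[simp] lemma gaussBinom_zero_right (q : R) (n : ℕ) : gaussBinom q n 0 = 1 := by
  cases n <;> rfl

@[simp] lemma gaussBinom_zero_succ (q : R) (k : ℕ) : gaussBinom q 0 (k + 1) = 0 := rfl

lemma gaussBinom_succ_succ (q : R) (n k : ℕ) :
    gaussBinom q (n + 1) (k + 1) = gaussBinom q n k + q ^ (k + 1) * gaussBinom q n (k + 1) := rfl

lemma gaussBinom_eq_zero_of_lt (q : R) {n k : ℕ} (h : n < k) : gaussBinom q n k = 0 := by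
  induction n generalizing k with
  | zero => obtain ⟨k, rfl⟩ := Nat.exists_eq_succ_of_ne_zero h.ne'; rfl
  | succ n ih =>
    obtain ⟨k, rfl⟩ := Nat.exists_eq_succ_of_ne_zero (Nat.ne_zero_of_lt h)
    rw [Nat.succ_eq_add_one, gaussBinom_succ_succ, ih (by omega), ih (by omega)]
    simp

/-- The `q`-Vandermonde convolution, for any array obeying the Pascal recursion. -/
lemma sum_gaussBinom_mul (q : R) (c : ℕ → ℕ → R)
    (hc : ∀ t j, c (t + 1) (j + 1) = c t j + q ^ (j + 1) * c t (j + 1)) (a t s : ℕ) :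
    ∑ i ∈ range (a + 1), q ^ (i * (i + s)) * gaussBinom q a i * c t (i + s) =
      c (t + a) (a + s) := by
  induction a generalizing t s with
  | zero => simp
  | succ a ih =>
    -- Lowering `a` by one raises both `t` and `s` by one: Pascal is applied to the Gaussian
    -- binomial on one side and to `c` on the other, and the leftover sums agree after an index
    -- shift.
    have split_left : ∀ i, q ^ ((i + 1) * (i + 1 + s)) * gaussBinom q (a + 1) (i + 1) *
          c t (i + 1 + s) =
        q ^ (i * (i + (s + 1))) * gaussBinom q a i * (q ^ (i + s + 1) * c t (i + s + 1)) +
          q ^ ((i + 1) * (i + 1 + (s + 1))) * gaussBinom q a (i + 1) * c t (i + 1 + s) := by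
      intro i
      rw [gaussBinom_succ_succ, show i + 1 + s = i + s + 1 by ring]
      ring
    have shift : ∑ i ∈ range (a + 1), q ^ (i * (i + (s + 1))) * gaussBinom q a i * c t (i + s) =
        ∑ i ∈ range (a + 1), q ^ ((i + 1) * (i + 1 + (s + 1))) * gaussBinom q a (i + 1) *
          c t (i + 1 + s) + c t s := by
      rw [sum_range_succ', sum_range_succ _ a, gaussBinom_eq_zero_of_lt q (Nat.lt_succ_self a)]
      simp
    have split_right : ∀ i, q ^ (i * (i + (s + 1))) * gaussBinom q a i *
          c (t + 1) (i + (s + 1)) =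
        q ^ (i * (i + (s + 1))) * gaussBinom q a i * c t (i + s) +
          q ^ (i * (i + (s + 1))) * gaussBinom q a i * (q ^ (i + s + 1) * c t (i + s + 1)) := by
      intro i
      rw [← mul_add, ← hc t (i + s), add_assoc i s 1]
    rw [show t + (a + 1) = t + 1 + a by ring, show a + 1 + s = a + (s + 1) by ring,
      ← ih (t + 1) (s + 1), sum_range_succ']
    simp only [split_left, split_right, sum_add_distrib, shift]
    simp
    ring

end Semiring

lemma qPoch_ne_zero {K : Type*} [Field K] {q : K} (hq : ∀ n, 1 + q ^ (n + 1) ≠ 0) (n : ℕ) : qPoch q n ≠ 0 :=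
  prod_ne_zero_iff.2 fun i _ => hq i

/-! ### The Bailey chain in characteristic two. -/

section CharTwo

variable {K : Type*} [Field K] [CharP K 2]

lemma gaussBinom_mul_qPoch_mul_qPoch {R : Type*} [CommRing R] [CharP R 2] (q : R) (a b : ℕ) :
    gaussBinom q (a + b) a * qPoch q a * qPoch q b = qPoch q (a + b) := by
  induction a generalizing b with
  | zero => simp
  | succ a iha =>
    induction b with
    | zero =>
      have := iha 0
      rw [add_zero, qPoch_zero, mul_one] at *
      rw [gaussBinom_succ_succ, gaussBinom_eq_zero_of_lt q (Nat.lt_succ_self a), qPoch_succ]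
      linear_combination (1 + q ^ (a + 1)) * this
    | succ b ihb =>
      have h1 := iha (b + 1)
      rw [show a + 1 + (b + 1) = a + (b + 1) + 1 by ring, gaussBinom_succ_succ, qPoch_succ q a,
        qPoch_succ q (a + (b + 1))]
      rw [show a + 1 + b = a + (b + 1) by ring, qPoch_succ q a] at ihb
      have h2 : (2 : R) = 0 := CharTwo.two_eq_zero
      rw [qPoch_succ q b] at *
      linear_combination (1 + q ^ (a + 1)) * h1 + q ^ (a + 1) * (1 + q ^ (b + 1)) * ihb +
        q ^ (a + 1) * qPoch q (a + (b + 1)) * h2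

lemma qPoch_sq {R : Type*} [CommRing R] [CharP R 2] (q : R) (n : ℕ) :
    qPoch (q ^ 2) n = qPoch q n ^ 2 := by
  rw [qPoch, qPoch, ← prod_pow]
  refine prod_congr rfl fun i _ => ?_
  rw [CharTwo.add_sq]; ring

/-- A symmetric form of the `q`-Vandermonde convolution. -/
lemma sum_pow_div_qPoch {q : K} (hq : ∀ n, 1 + q ^ (n + 1) ≠ 0) (a s : ℕ) :
    ∑ i ∈ range (a + 1), q ^ (i * (i + s)) /
        (qPoch q (a - i) ^ 2 * (qPoch q i * qPoch q (i + s))) =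
      qPoch q (2 * a + s) / (qPoch q a * qPoch q (a + s)) ^ 2 := by
  have hP := qPoch_ne_zero hq
  have h := sum_gaussBinom_mul q (gaussBinom q) (gaussBinom_succ_succ q) a (a + s) s
  have h2 := gaussBinom_mul_qPoch_mul_qPoch q (a + s) a
  rw [show a + s + a = 2 * a + s by ring] at *
  rw [eq_div_of_mul_eq (mul_ne_zero (hP _) (hP _)) ((mul_assoc _ _ _).symm.trans h2)] at h
  have : qPoch q (2 * a + s) / (qPoch q a * qPoch q (a + s)) ^ 2 =
      (qPoch q (2 * a + s) / (qPoch q (a + s) * qPoch q a)) / (qPoch q a * qPoch q (a + s)) := by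
    have := hP a; have := hP (a + s); field_simp
  rw [this, ← h, sum_div]
  refine sum_congr rfl fun i hi => ?_
  obtain ⟨d, rfl⟩ := Nat.exists_eq_add_of_le (Nat.lt_succ_iff.1 (mem_range.1 hi))
  have h3 := gaussBinom_mul_qPoch_mul_qPoch q i d
  have h4 := gaussBinom_mul_qPoch_mul_qPoch q (i + s) d
  rw [show i + s + d = i + d + s by ring] at h4
  rw [← h3, ← h4, Nat.add_sub_cancel_left]
  have := hP i; have := hP d; have := hP (i + s)
  have h5 : gaussBinom q (i + d) i ≠ 0 := by
    intro h0; rw [h0] at h3; exact hP (i + d) (by simpa using h3.symm)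
  have h6 : gaussBinom q (i + d + s) (i + s) ≠ 0 := by
    intro h0; rw [h0] at h4; exact hP (i + d + s) (by simpa using h4.symm)
  field_simp

/-- The limiting form of `sum_pow_div_qPoch` in which one of the two indices is infinite. -/
lemma sum_pow_div_qPoch' {q : K} (hq : ∀ n, 1 + q ^ (n + 1) ≠ 0) (a s : ℕ) :
    ∑ i ∈ range (a + 1), q ^ (i * (i + s)) /
        (qPoch q (a - i) * (qPoch q i * qPoch q (i + s))) =
      1 / (qPoch q a * qPoch q (a + s)) := by
  have hP := qPoch_ne_zero hq
  -- The array is constant in `t`, being the formal limit of `gaussBinom q t j` as t → ∞.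
  have h := sum_gaussBinom_mul q (fun _ j => 1 / qPoch q j) (fun _ j => by
    rw [qPoch_succ]; 
    have := hP j; have := hq j
    have h2 : (2 : K) = 0 := CharTwo.two_eq_zero
    field_simp
    linear_combination -q ^ (j + 1) * h2) a 0 s
  rw [show 1 / (qPoch q a * qPoch q (a + s)) = 1 / qPoch q (a + s) / qPoch q a by
    have := hP a; have := hP (a + s); field_simp, ← h, sum_div]
  refine sum_congr rfl fun i hi => ?_
  obtain ⟨d, rfl⟩ := Nat.exists_eq_add_of_le (Nat.lt_succ_iff.1 (mem_range.1 hi))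
  have h3 := gaussBinom_mul_qPoch_mul_qPoch q i d
  have h5 : gaussBinom q (i + d) i ≠ 0 := by
    intro h0; rw [h0] at h3; exact hP (i + d) (by simpa using h3.symm)
  rw [← h3, Nat.add_sub_cancel_left]
  have := hP i; have := hP d; have := hP (i + s)
  field_simp

/-- The coefficients `q ^ (r (r - 1) / 2) + q ^ (r (r + 1) / 2)` of the unit Bailey pair. -/
def unitBailey {R : Type*} [CommSemiring R] (q : R) (r : ℕ) : R :=
  if r = 0 then 1 else q ^ (r * (r - 1) / 2) * (1 + q ^ r)

lemma unitBailey_succ {R : Type*} [CommSemiring R] (q : R) (r : ℕ) :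
    unitBailey q (r + 1) = q ^ (r * (r + 1) / 2) * (1 + q ^ (r + 1)) := by
  simp [unitBailey, mul_comm]

/-- With k = j + d + 1 fixed, the partial sums up to j < k have a closed form, so the full sum
telescopes; the term r = k is added in `sum_unitBailey`. -/
lemma sum_unitBailey_partial {q : K} (hq : ∀ n, 1 + q ^ (n + 1) ≠ 0) (j d : ℕ) :
    ∑ r ∈ range (j + 1),
        unitBailey q r / (qPoch q (j + d + 1 - r) * qPoch q (j + d + 1 + r)) =
      q ^ (j * (j + 1) / 2) /
        ((1 + q ^ (j + d + 1)) * (qPoch q d * qPoch q (j + d + 1 + j))) := by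
  have hP := qPoch_ne_zero hq
  induction j generalizing d with
  | zero =>
    have := hP d; have := hq d
    simp [unitBailey, qPoch_succ]
    field_simp
  | succ j ih =>
    have h := ih (d + 1)
    rw [show j + (d + 1) + 1 = j + 1 + d + 1 by ring] at h
    rw [sum_range_succ, h, unitBailey_succ]
    have e1 : (j + 1) * (j + 1 + 1) / 2 = j * (j + 1) / 2 + (j + 1) := by
      rw [show (j + 1) * (j + 1 + 1) = j * (j + 1) + (j + 1) * 2 by ring,
        Nat.add_mul_div_right _ _ two_pos]
    rw [show j + 1 + d + 1 - (j + 1) = d + 1 by omega,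
      show j + 1 + d + 1 + (j + 1) = j + 1 + d + 1 + j + 1 by ring, qPoch_succ q d,
      qPoch_succ q (j + 1 + d + 1 + j), e1]
    have := hP d; have := hP (j + 1 + d + 1 + j); have := hq (j + 1 + d); have := hq d
    have := hq (j + 1 + d + 1 + j)
    have h2 : (2 : K) = 0 := CharTwo.two_eq_zero
    field_simp
    linear_combination q ^ (j * (j + 1) / 2) * (1 + q ^ (j + 1 + d + 1 + j + 1)) * h2

lemma sum_unitBailey {q : K} (hq : ∀ n, 1 + q ^ (n + 1) ≠ 0) (k : ℕ) :
    ∑ r ∈ range (k + 1), unitBailey q r / (qPoch q (k - r) * qPoch q (k + r)) =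
      if k = 0 then 1 else 0 := by
  have hP := qPoch_ne_zero hq
  rcases k with _ | k
  · simp [unitBailey]
  · have h := sum_unitBailey_partial hq k 0
    rw [sum_range_succ, if_neg (Nat.succ_ne_zero k)]
    simp only [add_zero] at h
    rw [h, unitBailey_succ, Nat.sub_self, show k + 1 + (k + 1) = k + 1 + k + 1 by ring,
      qPoch_succ q (k + 1 + k), qPoch_zero]
    have := hP (k + 1 + k); have := hq k; have := hq (k + 1 + k)
    have h2 : (2 : K) = 0 := CharTwo.two_eq_zero
    field_simp
    linear_combination q ^ (k * (k + 1) / 2) * (1 + q ^ (k + 1) + q ^ (2 * (k + 1))) * h2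

lemma sum_range_eq_sum_shift {M : Type*} [AddCommMonoid M] (f : ℕ → ℕ → M) (n : ℕ) :
    ∑ k ∈ range (n + 1), ∑ r ∈ range (k + 1), f k r =
      ∑ r ∈ range (n + 1), ∑ i ∈ range (n - r + 1), f (r + i) r := by
  rw [sum_sigma', sum_sigma']
  refine sum_nbij' (fun x => ⟨x.2, x.1 - x.2⟩) (fun x => ⟨x.1 + x.2, x.1⟩) ?_ ?_ ?_ ?_ ?_
  · rintro ⟨a, b⟩ h; simp at h ⊢; omega
  · rintro ⟨a, b⟩ h; simp at h ⊢; omega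
  · rintro ⟨a, b⟩ h; simp at h ⊢; omega
  · rintro ⟨a, b⟩ h; simp at h ⊢
  · rintro ⟨a, b⟩ h; simp at h ⊢; congr; omega

/-- A limiting case of the `q`-Dixon sum. -/
lemma sum_unitBailey_mul_pow {q : K} (hq : ∀ n, 1 + q ^ (n + 1) ≠ 0) (n : ℕ) :
    ∑ r ∈ range (n + 1), unitBailey q r * q ^ r ^ 2 / (qPoch q (n - r) * qPoch q (n + r)) ^ 2 =
      1 / (qPoch q n ^ 2 * qPoch q (2 * n)) := by
  have hP := qPoch_ne_zero hq
  -- Bailey's lemma: sum over `r` first and only k = 0 survives; sum over `k` first and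
  -- `sum_pow_div_qPoch` applies.
  have h := sum_range_eq_sum_shift (fun k r => q ^ k ^ 2 / qPoch q (n - k) ^ 2 *
    (unitBailey q r / (qPoch q (k - r) * qPoch q (k + r)))) n
  simp only [← mul_sum, sum_unitBailey hq] at h
  rw [sum_range_succ'] at h
  simp at h
  rw [← div_div, eq_comm, div_eq_iff (hP _), sum_mul, one_div, h]
  refine sum_congr rfl fun r hr => ?_
  obtain ⟨d, rfl⟩ := Nat.exists_eq_add_of_le (Nat.lt_succ_iff.1 (mem_range.1 hr))
  have h1 := sum_pow_div_qPoch hq d (2 * r)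
  rw [Nat.add_sub_cancel_left, show 2 * (r + d) = 2 * d + 2 * r by ring,
    show r + d + r = d + 2 * r by ring, div_mul_eq_mul_div, mul_div_assoc, ← h1, mul_sum]
  refine sum_congr rfl fun i hi => ?_
  rw [show r + d - (r + i) = d - i by omega, show r + i + r = i + 2 * r by ring,
    show (r + i) ^ 2 = r ^ 2 + i * (i + 2 * r) by ring, pow_add]
  field_simp

/-- A polynomial form of the Rogers–Selberg identity modulo two. -/
lemma sum_pow_div_qPoch_eq_sum_unitBailey {q : K} (hq : ∀ n, 1 + q ^ (n + 1) ≠ 0) (N : ℕ) :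
    ∑ n ∈ range (N + 1),
        q ^ (2 * n ^ 2) / (qPoch q (N - n) ^ 2 * (qPoch q n ^ 2 * qPoch q (2 * n))) =
      ∑ r ∈ range (N + 1),
        unitBailey q r * q ^ (3 * r ^ 2) / (qPoch q (N - r) * qPoch q (N + r)) ^ 2 := by
  have hP := qPoch_ne_zero hq
  have hq2 : ∀ n, 1 + (q ^ 2) ^ (n + 1) ≠ 0 := fun n => by
    have := pow_ne_zero 2 (hq n)
    rw [CharTwo.add_sq] at this
    rwa [← pow_mul, mul_comm 2, pow_mul, ← one_pow 2]
  have h := sum_range_eq_sum_shift (fun n r => q ^ (2 * n ^ 2) / qPoch q (N - n) ^ 2 *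
    (unitBailey q r * q ^ r ^ 2 / (qPoch q (n - r) * qPoch q (n + r)) ^ 2)) N
  simp only [← mul_sum, sum_unitBailey_mul_pow hq] at h
  refine Eq.trans (sum_congr rfl fun n _ => ?_) (h.trans (sum_congr rfl fun r hr => ?_))
  · field_simp
  · obtain ⟨d, rfl⟩ := Nat.exists_eq_add_of_le (Nat.lt_succ_iff.1 (mem_range.1 hr))
    -- The squared denominators are `q`-Pochhammer symbols in base q², so this step runs in that
    -- base.
    have h1 := sum_pow_div_qPoch' hq2 d (2 * r)
    simp only [qPoch_sq, ← mul_pow] at h1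
    rw [Nat.add_sub_cancel_left, show r + d + r = d + 2 * r by ring, ← mul_one_div, ← h1, mul_sum]
    refine sum_congr rfl fun i hi => ?_
    rw [show r + d - (r + i) = d - i by omega, show r + i + r = i + 2 * r by ring,
      show 2 * (r + i) ^ 2 = 2 * r ^ 2 + 2 * (i * (i + 2 * r)) by ring, pow_add,
      show 3 * r ^ 2 = r ^ 2 + 2 * r ^ 2 by ring, pow_add, ← pow_mul, Nat.add_sub_cancel_left]
    field_simp

end CharTwo

/-! ### Clearing denominators. -/

section Domain

/-- The quotient `qPoch q b / qPoch q a` as a product. -/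
def qPochIco {R : Type*} [CommSemiring R] (q : R) (a b : ℕ) : R :=
  ∏ i ∈ Ico a b, (1 + q ^ (i + 1))

/-- The product `(1 + q) (1 + q ^ 3) ⋯ (1 + q ^ (2 * n - 1))`. -/
def oddPoch {R : Type*} [CommSemiring R] (q : R) (n : ℕ) : R :=
  ∏ i ∈ range n, (1 + q ^ (2 * i + 1))

lemma qPoch_mul_qPochIco {R : Type*} [CommSemiring R] (q : R) {a b : ℕ} (h : a ≤ b) :
    qPoch q a * qPochIco q a b = qPoch q b :=
  prod_range_mul_prod_Ico _ h

/-- The factors with even exponent are squares, 1+q^(2i) = (1+q^i)². This turns the denominator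
(q)_n² (q)_{2n} into the odd product of the generating function. -/
lemma qPoch_two_mul {R : Type*} [CommRing R] [CharP R 2] (q : R) (n : ℕ) :
    qPoch q (2 * n) = oddPoch q n * qPoch q n ^ 2 := by
  induction n with
  | zero => simp [oddPoch]
  | succ n ih =>
    have h : (1 + q ^ (n + 1)) ^ 2 = 1 + q ^ (2 * n + 1 + 1) := by rw [CharTwo.add_sq]; ring
    rw [show 2 * (n + 1) = 2 * n + 1 + 1 by ring, qPoch_succ, qPoch_succ, ih, qPoch_succ q n,
      mul_pow, h, oddPoch, oddPoch, prod_range_succ]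
    ring

lemma sum_pow_mul_qPochIco_field {K : Type*} [Field K] [CharP K 2] {q : K}
    (hq : ∀ n, 1 + q ^ (n + 1) ≠ 0) (N : ℕ) :
    ∑ n ∈ range (N + 1), q ^ (2 * n ^ 2) * qPochIco q (N - n) N ^ 2 *
        (oddPoch q n * qPochIco q (2 * n) (2 * N) ^ 2) =
      ∑ r ∈ range (N + 1), unitBailey q r * q ^ (3 * r ^ 2) *
        (qPochIco q (N - r) N * qPochIco q (N + r) (2 * N)) ^ 2 := by
  have hP := qPoch_ne_zero hq
  have h := congrArg (· * (qPoch q N * qPoch q (2 * N)) ^ 2)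
    (sum_pow_div_qPoch_eq_sum_unitBailey hq N)
  simp only [sum_mul] at h
  refine Eq.trans (sum_congr rfl fun n hn => ?_) (h.trans (sum_congr rfl fun n hn => ?_)) <;>
    have hn := Nat.lt_succ_iff.1 (mem_range.1 hn)
  · have h1 := qPoch_mul_qPochIco q (Nat.sub_le N n)
    have h2 := qPoch_mul_qPochIco q (Nat.mul_le_mul_left 2 hn)
    have h3 := qPoch_two_mul q n
    have := hP (N - n); have := hP n; have := hP (2 * n)
    rw [← h1, ← h2]
    field_simp
    rw [h3]
    ring
  · have h1 := qPoch_mul_qPochIco q (Nat.sub_le N n)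
    have h2 := qPoch_mul_qPochIco q (show N + n ≤ 2 * N by omega)
    have := hP (N - n); have := hP (N + n)
    rw [← h1, ← h2]
    field_simp

/-- Free of division, the identity descends from the fraction field and can be used at `X` in the
power series ring. -/
lemma sum_pow_mul_qPochIco {R : Type*} [CommRing R] [IsDomain R] [CharP R 2] {q : R}
    (hq : ∀ n, 1 + q ^ (n + 1) ≠ 0) (N : ℕ) :
    ∑ n ∈ range (N + 1), q ^ (2 * n ^ 2) * qPochIco q (N - n) N ^ 2 *
        (oddPoch q n * qPochIco q (2 * n) (2 * N) ^ 2) =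
      ∑ r ∈ range (N + 1), unitBailey q r * q ^ (3 * r ^ 2) *
        (qPochIco q (N - r) N * qPochIco q (N + r) (2 * N)) ^ 2 := by
  have hinj := IsFractionRing.injective R (FractionRing R)
  have : CharP (FractionRing R) 2 := charP_of_injective_algebraMap hinj 2
  have hq' : ∀ n, 1 + (algebraMap R (FractionRing R) q) ^ (n + 1) ≠ 0 := fun n h =>
    hq n (hinj (by simpa using h))
  refine hinj ?_
  have h := sum_pow_mul_qPochIco_field hq' N
  simpa [qPochIco, oddPoch, unitBailey, apply_ite] using h

end Domain

/-! ### Coefficients of the power series identity. -/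

section Truncation

open PowerSeries

variable {R : Type*} [CommRing R]

lemma qPochIco_sub_one_dvd (q : R) (a b : ℕ) : q ^ (a + 1) ∣ qPochIco q a b - 1 := by
  rw [qPochIco]
  refine prod_induction _ (fun x => q ^ (a + 1) ∣ x - 1) ?_ (by simp) ?_
  · intro x y hx hy
    rw [show x * y - 1 = (x - 1) * y + (y - 1) by ring]
    exact dvd_add (hx.mul_right _) hy
  · intro i hi
    rw [add_sub_cancel_left]
    exact pow_dvd_pow _ (by simp at hi; omega)

lemma qPochIco_sq_sub_one_dvd {q : R} {a b k : ℕ} (h : k ≤ a + 1) :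
    q ^ k ∣ qPochIco q a b ^ 2 - 1 := by
  rw [show qPochIco q a b ^ 2 - 1 = (qPochIco q a b - 1) * (qPochIco q a b + 1) by ring]
  exact ((pow_dvd_pow _ h).trans (qPochIco_sub_one_dvd q a b)).mul_right _

lemma coeff_eq_of_dvd_sub {f g : R⟦X⟧} {t N : ℕ} (htN : t < N) (h : X ^ N ∣ f - g) :
    coeff t f = coeff t g := by
  have := (X_pow_dvd_iff.1 h) t htN
  rwa [map_sub, sub_eq_zero] at this

/-- The Rogers–Selberg identity modulo two, for one coefficient of the power series. -/
lemma coeff_sum_oddPoch {t N : ℕ} (h : t ≤ N) :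
    coeff t (∑ n ∈ range (N + 1), (X : (ZMod 2)⟦X⟧) ^ (2 * n ^ 2) *
        (oddPoch X n * qPochIco X (2 * n) (2 * N) ^ 2)) =
      coeff t (∑ r ∈ range (N + 1), unitBailey (X : (ZMod 2)⟦X⟧) r * X ^ (3 * r ^ 2)) := by
  have hX : ∀ n, 1 + (X : (ZMod 2)⟦X⟧) ^ (n + 1) ≠ 0 := fun n h => by
    have := congrArg (constantCoeff (R := ZMod 2)) h
    simp at this
  have : CharP (ZMod 2)⟦X⟧ 2 := charP_of_injective_algebraMap (R := ZMod 2)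
    (FaithfulSMul.algebraMap_injective _ _) 2
  have key := sum_pow_mul_qPochIco hX N
  refine Eq.trans ?_ ((congrArg (coeff t) key).trans ?_)
  · refine (coeff_eq_of_dvd_sub (Nat.lt_succ_of_le h) ?_).symm
    rw [← sum_sub_distrib]
    refine dvd_sum fun n hn => ?_
    have hn := Nat.lt_succ_iff.1 (mem_range.1 hn)
    rw [← sub_mul, ← mul_sub_one]
    -- The cutoff factor is 1 only modulo X^(N-n+1); since n ≤ n², the factor X^(2n²) makes up the
    -- missing n.
    refine ((pow_dvd_pow _ (?_ : N + 1 ≤ 2 * n ^ 2 + (N - n + 1))).trans ?_).mul_right _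
    · have := Nat.le_self_pow two_ne_zero n; omega
    · rw [pow_add]
      exact mul_dvd_mul_left _ (qPochIco_sq_sub_one_dvd le_rfl)
  · refine coeff_eq_of_dvd_sub (Nat.lt_succ_of_le h) ?_
    rw [← sum_sub_distrib]
    refine dvd_sum fun n hn => ?_
    have hn := Nat.lt_succ_iff.1 (mem_range.1 hn)
    rw [← mul_sub_one, mul_assoc]
    refine ((pow_dvd_pow _ (?_ : N + 1 ≤ 3 * n ^ 2 + (N - n + 1))).trans ?_).mul_left _
    · have := Nat.le_self_pow two_ne_zero n; omega
    · rw [pow_add]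
      refine mul_dvd_mul_left _ ?_
      rw [mul_pow, show ∀ x y : (ZMod 2)⟦X⟧, x * y - 1 = (x - 1) * y + (y - 1) by
        intros; ring]
      exact dvd_add ((qPochIco_sq_sub_one_dvd le_rfl).mul_right _)
        (qPochIco_sq_sub_one_dvd (by omega))

lemma two_mul_half_exponent (r : ℕ) :
    2 * (r * (r + 1) / 2 + 3 * (r + 1) ^ 2) + (r + 1) = 7 * (r + 1) ^ 2 := by
  have := Nat.two_mul_div_two_of_even (Nat.even_mul_succ_self r)
  rw [mul_add, this]; ring

lemma unitBailey_succ_mul_pow (r : ℕ) :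
    unitBailey (X : R⟦X⟧) (r + 1) * X ^ (3 * (r + 1) ^ 2) =
      X ^ (r * (r + 1) / 2 + 3 * (r + 1) ^ 2) +
        X ^ (r * (r + 1) / 2 + 3 * (r + 1) ^ 2 + (r + 1)) := by
  rw [unitBailey_succ]; ring

lemma eq_of_seven_mul_sq_add {j l : ℤ} (h : 7 * j ^ 2 + j = 7 * l ^ 2 + l) : j = l := by
  have h1 : (j - l) * (7 * (j + l) + 1) = 0 := by linear_combination h
  rcases mul_eq_zero.1 h1 with h | h <;> omega

/-- For r > 0 the two monomials have exponents (7j²+j)/2 with j = -r and j = r; for r = 0 the two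
values of j coincide, and `unitBailey` counts them once. -/
lemma coeff_unitBailey_mul_pow (t r : ℕ) :
    coeff t (unitBailey (X : R⟦X⟧) r * X ^ (3 * r ^ 2)) =
      if 2 * (t : ℤ) = 7 * (r : ℤ) ^ 2 + r ∨ 2 * (t : ℤ) = 7 * (-r : ℤ) ^ 2 + -r
      then 1 else 0 := by
  rcases r with _ | r
  · simp [unitBailey, coeff_one]
  · rw [unitBailey_succ_mul_pow, map_add, coeff_X_pow, coeff_X_pow]
    have h := two_mul_half_exponent r
    set e := r * (r + 1) / 2 + 3 * (r + 1) ^ 2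
    have h' : 2 * (e : ℤ) + (r + 1) = 7 * ((r + 1 : ℕ) : ℤ) ^ 2 := by exact_mod_cast h
    have e1 : (2 * (t : ℤ) = 7 * ((r + 1 : ℕ) : ℤ) ^ 2 + (r + 1 : ℕ)) ↔ t = e + (r + 1) := by
      rw [← h']; push_cast; omega
    have e2 : (2 * (t : ℤ) = 7 * (-(r + 1 : ℕ) : ℤ) ^ 2 + -(r + 1 : ℕ)) ↔ t = e := by
      rw [neg_sq, ← h']; push_cast; omega
    simp only [e1, e2]
    by_cases h1 : t = e
    · simp [h1]
    · simp [h1]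

lemma coeff_sum_unitBailey {t N : ℕ} (htN : t ≤ N)
    [Decidable (∃ j : ℤ, 2 * (t : ℤ) = 7 * j ^ 2 + j)] :
    coeff t (∑ r ∈ range (N + 1), unitBailey (X : R⟦X⟧) r * X ^ (3 * r ^ 2)) =
      if ∃ j : ℤ, 2 * (t : ℤ) = 7 * j ^ 2 + j then 1 else 0 := by
  simp only [map_sum, coeff_unitBailey_mul_pow]
  split_ifs with h
  · obtain ⟨j, hj⟩ := h
    rw [sum_eq_single j.natAbs]
    · rw [if_pos]
      rcases Int.natAbs_eq j with h | h
      · left; rw [← h, hj]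
      · right; rw [← h, hj]
    · intro r _ hr
      rw [if_neg]
      rintro (h | h)
      · exact hr (by have := eq_of_seven_mul_sq_add (hj.symm.trans h); omega)
      · exact hr (by have := eq_of_seven_mul_sq_add (hj.symm.trans h); omega)
    -- A witness with |j| > N ≥ t would give 7j²+j ≥ 6j² > 2t.
    · intro hr
      exfalso
      rw [mem_range, not_lt] at hr
      have h1 : (j.natAbs : ℤ) ^ 2 = j ^ 2 := Int.natAbs_sq j
      have h2 : (t : ℤ) + 1 ≤ j.natAbs := by exact_mod_cast (by omega)
      have h3 : -(j.natAbs : ℤ) ≤ j := by omega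
      nlinarith
  · refine sum_eq_zero fun r _ => if_neg ?_
    rintro (h' | h')
    exacts [h ⟨_, h'⟩, h ⟨_, h'⟩]

end Truncation

/-! ### The generating function of `c5` modulo two. -/

section Combinatorics

lemma Nat.eq_zero_or_eq_odd_or_eq_even (x : ℕ) :
    x = 0 ∨ (∃ i, x = 2 * i + 1) ∨ ∃ i, x = 2 * (i + 1) := by
  rcases Nat.even_or_odd' x with ⟨i, rfl | rfl⟩
  · rcases i with _ | i
    · exact Or.inl rfl
    · exact Or.inr (Or.inr ⟨i, rfl⟩)
  · exact Or.inr (Or.inl ⟨i, rfl⟩)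

/-- The multiplicity conditions counted by `c5`, where `k` is the number of distinct odd parts. -/
def HasGapFreeCounts (s : Multiset ℕ) (k : ℕ) : Prop :=
  (∀ i < k, s.count (2 * i + 1) = 2 ∨ s.count (2 * i + 1) = 3) ∧
    (∀ i, k ≤ i → s.count (2 * i + 1) = 0) ∧
    (∀ i, 2 * k ≤ i → s.count (2 * (i + 1)) ≤ 1) ∧
    ∀ i < 2 * k, s.count (2 * (i + 1)) = 0

/-- With m = 2k-1, the bound 2m+4 is 2(2k+1), so the even parts 2(i+1) are those with i ≥ 2k. Taking
k = 0 covers the partitions without odd parts, which unifies both cases. -/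
lemma isDistinctEven_or_isGapFreeOdd_iff {n : ℕ} (p : n.Partition) :
    IsDistinctEven p ∨ IsGapFreeOdd p ↔ ∃ k, HasGapFreeCounts p.parts k := by
  constructor
  · rintro (⟨he, hd⟩ | ⟨m, hm, ⟨k, rfl⟩, hmax, hgap, hodd, heven⟩)
    · refine ⟨0, by simp, fun i _ => ?_, fun i _ => Multiset.nodup_iff_count_le_one.1 hd _,
        by simp⟩
      refine Multiset.count_eq_zero.2 fun h => ?_
      have := he _ h
      grind
    · refine ⟨k + 1, fun i hi => ?_, fun i hi => ?_, fun i hi => ?_, fun i hi => ?_⟩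
      · exact hodd _ (hgap _ (by omega) ⟨i, rfl⟩) ⟨i, rfl⟩
      · refine Multiset.count_eq_zero.2 fun h => ?_
        have := hmax _ h ⟨i, rfl⟩
        omega
      · by_cases h : 2 * (i + 1) ∈ p.parts
        · exact (heven _ h (even_two_mul _)).1.le
        · simp [Multiset.count_eq_zero.2 h]
      · refine Multiset.count_eq_zero.2 fun h => ?_
        have := (heven _ h (even_two_mul _)).2
        omega
  · rintro ⟨k, h1, h2, h3, h4⟩
    have even_iff : ∀ x ∈ p.parts, Even x →
        p.parts.count x = 1 ∧ ∃ i, 2 * k ≤ i ∧ x = 2 * (i + 1) := by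
      intro x hx hxe
      have hpos := p.parts_pos hx
      have hc := Multiset.count_pos.2 hx
      rcases Nat.eq_zero_or_eq_odd_or_eq_even x with rfl | ⟨i, rfl⟩ | ⟨i, rfl⟩
      · omega
      · grind
      · by_cases hi : 2 * k ≤ i
        · exact ⟨le_antisymm (h3 i hi) hc, i, hi, rfl⟩
        · exact absurd (h4 i (by omega)) hc.ne'
    have odd_lt : ∀ i, 2 * i + 1 ∈ p.parts → i < k := fun i hi =>
      not_le.1 fun h => (Multiset.count_pos.2 hi).ne' (h2 i h)
    rcases k with _ | k
    · have he : ∀ x ∈ p.parts, Even x := by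
        intro x hx
        by_contra hxo
        obtain ⟨i, rfl⟩ := Nat.not_even_iff_odd.1 hxo
        exact absurd (odd_lt i hx) (by omega)
      refine Or.inl ⟨he, Multiset.nodup_iff_count_le_one.2 fun x => ?_⟩
      by_cases hx : x ∈ p.parts
      · exact (even_iff x hx (he x hx)).1.le
      · simp [Multiset.count_eq_zero.2 hx]
    · have hmem : ∀ i < k + 1, 2 * i + 1 ∈ p.parts := fun i hi =>
        Multiset.count_pos.1 (by have := h1 i hi; omega)
      refine Or.inr ⟨2 * k + 1, hmem k (by omega), ⟨k, rfl⟩, ?_, ?_, ?_, ?_⟩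
      · rintro _ hx ⟨i, rfl⟩
        have := odd_lt i hx
        omega
      · rintro _ hx ⟨i, rfl⟩
        exact hmem i (by omega)
      · rintro _ hx ⟨i, rfl⟩
        exact h1 i (odd_lt i hx)
      · intro x hx hxe
        obtain ⟨hc, i, hi, rfl⟩ := even_iff x hx hxe
        exact ⟨hc, by omega⟩

/-- The multiset in which `1, 3, …, 2 * k - 1` appear twice, with one more copy of `2 * i + 1` for
`i ∈ A`, together with the even numbers `2 * (i + 1)` for `i ∈ B`. -/
def gapFreeMultiset (k : ℕ) (A B : Finset ℕ) : Multiset ℕ :=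
  2 • (range k).val.map (fun i => 2 * i + 1) + A.val.map (fun i => 2 * i + 1) +
    B.val.map (fun i => 2 * (i + 1))

lemma sum_gapFreeMultiset (k : ℕ) (A B : Finset ℕ) :
    (gapFreeMultiset k A B).sum =
      2 * k ^ 2 + (∑ i ∈ A, (2 * i + 1) + ∑ i ∈ B, 2 * (i + 1)) := by
  have h : ∑ i ∈ range k, (2 * i + 1) = k ^ 2 := by
    induction k with
    | zero => rfl
    | succ k ih => rw [sum_range_succ, ih]; ring
  rw [← h, gapFreeMultiset, Multiset.sum_add, Multiset.sum_add, Multiset.sum_nsmul, add_assoc]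
  rfl

lemma count_map_val_odd (A : Finset ℕ) (i : ℕ) :
    (A.val.map fun i => 2 * i + 1).count (2 * i + 1) = if i ∈ A then 1 else 0 := by
  rw [Multiset.count_map_eq_count' (fun i => 2 * i + 1) _ (fun a b h => by simpa using h),
    Multiset.count_eq_of_nodup A.nodup]
  rfl

lemma count_map_val_even (B : Finset ℕ) (i : ℕ) :
    (B.val.map fun i => 2 * (i + 1)).count (2 * (i + 1)) = if i ∈ B then 1 else 0 := by
  rw [Multiset.count_map_eq_count' (fun i => 2 * (i + 1)) _ (fun a b h => by simpa using h),
    Multiset.count_eq_of_nodup B.nodup]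
  rfl

lemma count_odd_gapFreeMultiset (k : ℕ) (A B : Finset ℕ) (i : ℕ) :
    (gapFreeMultiset k A B).count (2 * i + 1) =
      (if i < k then 2 else 0) + if i ∈ A then 1 else 0 := by
  have h : (B.val.map fun i => 2 * (i + 1)).count (2 * i + 1) = 0 := by
    refine Multiset.count_eq_zero.2 fun h => ?_
    obtain ⟨j, -, hj⟩ := Multiset.mem_map.1 h
    omega
  simp only [gapFreeMultiset, Multiset.count_add, Multiset.count_nsmul, count_map_val_odd, h,
    mem_range]
  split_ifs <;> rfl

lemma count_even_gapFreeMultiset (k : ℕ) (A B : Finset ℕ) (i : ℕ) :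
    (gapFreeMultiset k A B).count (2 * (i + 1)) = if i ∈ B then 1 else 0 := by
  have h : ∀ A : Finset ℕ, (A.val.map fun i => 2 * i + 1).count (2 * (i + 1)) = 0 := fun A => by
    refine Multiset.count_eq_zero.2 fun h => ?_
    obtain ⟨j, -, hj⟩ := Multiset.mem_map.1 h
    omega
  simp only [gapFreeMultiset, Multiset.count_add, Multiset.count_nsmul, count_map_val_even, h,
    mul_zero, zero_add]

lemma pos_of_mem_gapFreeMultiset {k : ℕ} {A B : Finset ℕ} {x : ℕ}
    (h : x ∈ gapFreeMultiset k A B) : 0 < x := by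
  simp only [gapFreeMultiset, Multiset.mem_add, Multiset.mem_nsmul, Multiset.mem_map] at h
  omega

lemma hasGapFreeCounts_gapFreeMultiset {k M : ℕ} {A B : Finset ℕ} (hA : A ⊆ range k)
    (hB : B ⊆ Ico (2 * k) M) : HasGapFreeCounts (gapFreeMultiset k A B) k := by
  refine ⟨fun i hi => ?_, fun i hi => ?_, fun i hi => ?_, fun i hi => ?_⟩
  · rw [count_odd_gapFreeMultiset, if_pos hi]
    split_ifs <;> simp
  · rw [count_odd_gapFreeMultiset, if_neg (by omega), if_neg]
    exact fun h => absurd (mem_range.1 (hA h)) (by omega)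
  · rw [count_even_gapFreeMultiset]
    split_ifs <;> simp
  · rw [count_even_gapFreeMultiset, if_neg]
    exact fun h => absurd (mem_Ico.1 (hB h)).1 (by omega)

lemma gapFreeMultiset_injective {k k' : ℕ} {A B A' B' : Finset ℕ}
    (hA : A ⊆ range k) (hA' : A' ⊆ range k')
    (h : gapFreeMultiset k A B = gapFreeMultiset k' A' B') : k = k' ∧ A = A' ∧ B = B' := by
  have hodd : ∀ i, ((if i < k then 2 else 0) + if i ∈ A then 1 else 0) =
      (if i < k' then 2 else 0) + if i ∈ A' then 1 else 0 := fun i => by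
    rw [← count_odd_gapFreeMultiset k A B, h, count_odd_gapFreeMultiset]
  have heven : ∀ i, (if i ∈ B then 1 else 0) = if i ∈ B' then 1 else 0 := fun i => by
    rw [← count_even_gapFreeMultiset k A B, h, count_even_gapFreeMultiset]
  have hlt : ∀ i, i < k ↔ i < k' := fun i => by
    have := hodd i
    have h1 : i ∈ A → i < k := fun h => mem_range.1 (hA h)
    have h2 : i ∈ A' → i < k' := fun h => mem_range.1 (hA' h)
    split_ifs at this <;> omega
  have hk : k = k' := eq_of_forall_lt_iff hlt
  subst hk
  refine ⟨rfl, ?_, ?_⟩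
  · ext i
    have := hodd i
    split_ifs at this <;> simp_all
  · ext i
    have := heven i
    split_ifs at this <;> simp_all

lemma exists_eq_gapFreeMultiset {s : Multiset ℕ} {k M : ℕ} (h0 : 0 ∉ s)
    (hM : ∀ x ∈ s, x ≤ M) (h : HasGapFreeCounts s k) :
    ∃ A ⊆ range k, ∃ B ⊆ Ico (2 * k) M, gapFreeMultiset k A B = s := by
  obtain ⟨h1, h2, h3, h4⟩ := h
  refine ⟨(range k).filter fun i => s.count (2 * i + 1) = 3, filter_subset _ _,
    (Ico (2 * k) M).filter fun i => 2 * (i + 1) ∈ s, filter_subset _ _, ?_⟩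
  ext x
  rcases Nat.eq_zero_or_eq_odd_or_eq_even x with rfl | ⟨i, rfl⟩ | ⟨i, rfl⟩
  · rw [Multiset.count_eq_zero.2 h0]
    exact Multiset.count_eq_zero.2 fun h => (pos_of_mem_gapFreeMultiset h).ne' rfl
  · rw [count_odd_gapFreeMultiset]
    simp only [mem_filter, mem_range]
    by_cases hi : i < k
    · rcases h1 i hi with h | h <;> simp [h, hi]
    · simp [hi, h2 i (not_lt.1 hi)]
  · rw [count_even_gapFreeMultiset]
    simp only [mem_filter, mem_Ico]
    by_cases hi : 2 * (i + 1) ∈ s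
    · have hc := Multiset.count_pos.2 hi
      have hki : 2 * k ≤ i := not_lt.1 fun h => hc.ne' (h4 i h)
      have := hM _ hi
      rw [if_pos ⟨⟨hki, by omega⟩, hi⟩]
      exact le_antisymm hc (h3 i hki)
    · simp [hi]

/-- The triples `⟨k, A, B⟩` that index the multisets `gapFreeMultiset k A B` counted by `c5`. -/
def gapFreeIndex (N : ℕ) : Finset (Σ _ : ℕ, Finset ℕ × Finset ℕ) :=
  (range (N + 1)).sigma fun k => (range k).powerset ×ˢ (Ico (2 * k) (2 * N)).powerset

lemma mem_gapFreeIndex {N k : ℕ} {A B : Finset ℕ} :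
    (⟨k, A, B⟩ : Σ _ : ℕ, Finset ℕ × Finset ℕ) ∈ gapFreeIndex N ↔
      k ≤ N ∧ A ⊆ range k ∧ B ⊆ Ico (2 * k) (2 * N) := by
  simp only [gapFreeIndex, mem_sigma, mem_range, mem_product, mem_powerset, Nat.lt_succ_iff]

/-- The index set is finite but large enough: 2k² ≤ t forces k ≤ N, and an even part 2(i+1) ≤ t has
i < 2N. -/
lemma c5_eq_card {t N : ℕ} (htN : t ≤ N) :
    c5 t = ((gapFreeIndex N).filter
      fun x => t = 2 * x.1 ^ 2 + (∑ i ∈ x.2.1, (2 * i + 1) + ∑ i ∈ x.2.2, 2 * (i + 1))).card := by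
  classical
  rw [c5, eq_comm]
  refine card_bij (fun x hx => ⟨gapFreeMultiset x.1 x.2.1 x.2.2, pos_of_mem_gapFreeMultiset,
    (sum_gapFreeMultiset _ _ _).trans (mem_filter.1 hx).2.symm⟩) ?_ ?_ ?_
  · rintro ⟨k, A, B⟩ hx
    obtain ⟨-, hA, hB⟩ := mem_gapFreeIndex.1 (mem_filter.1 hx).1
    exact mem_filter.2 ⟨mem_univ _, (isDistinctEven_or_isGapFreeOdd_iff _).2
      ⟨k, hasGapFreeCounts_gapFreeMultiset hA hB⟩⟩
  · rintro ⟨k, A, B⟩ hx ⟨k', A', B'⟩ hx' h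
    obtain ⟨-, hA, -⟩ := mem_gapFreeIndex.1 (mem_filter.1 hx).1
    obtain ⟨-, hA', -⟩ := mem_gapFreeIndex.1 (mem_filter.1 hx').1
    obtain ⟨rfl, rfl, rfl⟩ := gapFreeMultiset_injective hA hA' (congrArg Nat.Partition.parts h)
    rfl
  · intro p hp
    obtain ⟨k, hk⟩ := (isDistinctEven_or_isGapFreeOdd_iff p).1 (mem_filter.1 hp).2
    have hle : ∀ x ∈ p.parts, x ≤ t := fun x hx =>
      (Multiset.single_le_sum (fun _ _ => Nat.zero_le _) x hx).trans_eq p.parts_sum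
    obtain ⟨A, hA, B, hB, h⟩ := exists_eq_gapFreeMultiset (M := 2 * N)
      (fun h => (p.parts_pos h).ne' rfl) (fun x hx => (hle x hx).trans (by omega)) hk
    have hkN : k ≤ N := by
      have h1 := (sum_gapFreeMultiset k A B).symm
      rw [h, p.parts_sum] at h1
      have := Nat.le_self_pow two_ne_zero k
      omega
    refine ⟨⟨k, A, B⟩, mem_filter.2 ⟨mem_gapFreeIndex.2 ⟨hkN, hA, hB⟩, ?_⟩, ?_⟩
    · rw [← sum_gapFreeMultiset, h, p.parts_sum]
    · exact Nat.Partition.ext h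

open PowerSeries in
lemma coeff_sum_oddPoch_eq_c5 {t N : ℕ} (htN : t ≤ N) :
    coeff t (∑ n ∈ range (N + 1), (X : (ZMod 2)⟦X⟧) ^ (2 * n ^ 2) *
        (oddPoch X n * qPochIco X (2 * n) (2 * N) ^ 2)) = (c5 t : ZMod 2) := by
  have hchar : CharP (ZMod 2)⟦X⟧ 2 := charP_of_injective_algebraMap (R := ZMod 2)
    (FaithfulSMul.algebraMap_injective _ _) 2
  have h : ∑ n ∈ range (N + 1), (X : (ZMod 2)⟦X⟧) ^ (2 * n ^ 2) *
        (oddPoch X n * qPochIco X (2 * n) (2 * N) ^ 2) =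
      ∑ x ∈ gapFreeIndex N,
        X ^ (2 * x.1 ^ 2 + (∑ i ∈ x.2.1, (2 * i + 1) + ∑ i ∈ x.2.2, 2 * (i + 1))) := by
    rw [gapFreeIndex, sum_sigma]
    refine sum_congr rfl fun k _ => ?_
    have hsq : qPochIco (X : (ZMod 2)⟦X⟧) (2 * k) (2 * N) ^ 2 =
        ∏ i ∈ Ico (2 * k) (2 * N), (1 + X ^ (2 * (i + 1))) := by
      rw [qPochIco, ← prod_pow]
      refine prod_congr rfl fun i _ => ?_
      rw [CharTwo.add_sq]; ring
    -- Expanding both products over subsets yields one monomial for each pair (A, B).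
    rw [hsq, oddPoch, prod_one_add, prod_one_add, sum_mul_sum, ← sum_product', mul_sum]
    refine sum_congr rfl fun x _ => ?_
    rw [prod_pow_eq_pow_sum, prod_pow_eq_pow_sum, ← pow_add, ← pow_add]
  rw [h, c5_eq_card htN, map_sum]
  simp only [coeff_X_pow]
  rw [sum_boole]

end Combinatorics

theorem theorem6 (n : ℕ) :
    ((∃ j : ℤ, 2 * (n : ℤ) = 7 * j ^ 2 + j) → c5 n ≡ 1 [MOD 2]) ∧
    ((¬ ∃ j : ℤ, 2 * (n : ℤ) = 7 * j ^ 2 + j) → c5 n ≡ 0 [MOD 2]) := by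
  classical
  have h := (coeff_sum_oddPoch_eq_c5 le_rfl).symm.trans
    ((coeff_sum_oddPoch le_rfl).trans (coeff_sum_unitBailey (R := ZMod 2) (le_refl n)))
  rw [← ZMod.natCast_eq_natCast_iff, ← ZMod.natCast_eq_natCast_iff, h]
  exact ⟨fun hj => by simp [hj], fun hj => by simp [hj]⟩
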